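/- Let $G_S$ be the infinite square grid, i.e. the graph with vertex set $\mathbb{Z}^2$ in which $u$ and $v$ are adjacent if and only if $u-v\in\{(0,\pm1),(\pm1,0)\}$. For $u\in\mathbb{Z}^2$ let $B_2(u)$ be the set of all vertices at graph distance at most $2$ from $u$. A nonempty set $C\subseteq\mathbb{Z}^2$ is called a $2$-identifying code in $G_S$ if $B_2(u)\cap C\neq\emptyset$ for every $u\in\mathbb{Z}^2$ and $B_2(u)\cap C\neq B_2(v)\cap C$ for all $u\neq v$ in $\mathbb{Z}^2$. Put $Q_n=\{(x,y)\in\mathbb{Z}^2 : |x|\le n,\ |y|\le n\}$ and let $$D(C)=\limsup_{n\to\infty}\frac{|C\cap Q_n|}{|Q_n|}$$ be the density of $C$. Theorem. If $C$ is a $2$-identifying code in the square grid $G_S$, then $$D(C)\ \ge\ \frac{6}{35}.$$ -/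

import Mathlib

/-- The closed ball of radius `r` centered at `u` in the graph `G`: all vertices at graph distance
at most `r` from `u` (vertices in other components are at distance `⊤`). -/
def graphBall {V : Type*} (G : SimpleGraph V) (r : ℕ) (u : V) : Set V :=
  {x | G.edist u x ≤ (r : ℕ∞)}

/-- The identifying set `I_r(C; u) = B_r(u) ∩ C` of the vertex `u` with respect to `C`. -/
def identifyingSet {V : Type*} (G : SimpleGraph V) (r : ℕ) (C : Set V) (u : V) : Set V :=
  graphBall G r u ∩ C

/-- `C` is an `r`-identifying code in `G`: a nonempty set of vertices such that the identifying
sets of all vertices are nonempty and pairwise distinct. -/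
structure IsIdentifyingCode {V : Type*} (G : SimpleGraph V) (r : ℕ) (C : Set V) : Prop where
  nonempty : C.Nonempty
  covers : ∀ u : V, (identifyingSet G r C u).Nonempty
  separates : ∀ u v : V, u ≠ v → identifyingSet G r C u ≠ identifyingSet G r C v

/-- The infinite square grid on `ℤ²`: `u` and `v` are adjacent if and only if
`u - v ∈ {(0, ±1), (±1, 0)}`. -/
def squareGrid : SimpleGraph (ℤ × ℤ) where
  Adj u v := u - v ∈ ({(0, 1), (0, -1), (1, 0), (-1, 0)} : Set (ℤ × ℤ))
  symm := ⟨by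
    rintro ⟨a, b⟩ ⟨c, d⟩ h
    simp only [Prod.mk_sub_mk, Set.mem_insert_iff, Set.mem_singleton_iff, Prod.mk.injEq] at h ⊢
    omega⟩
  loopless := ⟨by
    rintro ⟨a, b⟩ h
    simp only [Prod.mk_sub_mk, Set.mem_insert_iff, Set.mem_singleton_iff, Prod.mk.injEq] at h
    omega⟩

/-- The square `Q_n = {(x, y) ∈ ℤ² : |x| ≤ n, |y| ≤ n}`. -/
def gridSquare (n : ℕ) : Set (ℤ × ℤ) :=
  {p | |p.1| ≤ (n : ℤ) ∧ |p.2| ≤ (n : ℤ)}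

/-- The density `D(C) = limsup_{n → ∞} |C ∩ Q_n| / |Q_n|` of a set `C ⊆ ℤ²`. -/
noncomputable def gridDensity (C : Set (ℤ × ℤ)) : ℝ :=
  Filter.limsup
    (fun n : ℕ => ((C ∩ gridSquare n).ncard : ℝ) / ((gridSquare n).ncard : ℝ)) Filter.atTop

/-! The proof is a discharging argument. Every vertex splits one unit, counted as 48, among the
codewords of its identifying set. A codeword receives only from the 13 vertices of its ball, and by
`received_le` it never receives more than 280. Double counting over a large square (`card_box_le`)
then gives density at least 48/280 = 6/35, the boundary being negligible.

A set of four or more codewords gives 12 to each. Pairs and triples are split evenly, with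
exceptions: in a pair, a codeword at distance two along an axis (a tip) takes 1, 2 or 4 from a
partner at the centre, beside it or on a diagonal, and twelve triples penalise one distinguished
member.

What a codeword receives depends only on the 9 × 9 window around it, and the bound 280 uses only
that the 13 vertices of its ball are separated. It is proved by a branching search over a set `O` of
cells known to be codewords and a set `Z` of cells known not to be. Among the balls with the same
trace on `O`, at most one contains no further codeword; the others have larger identifying sets and
are capped by `nextCap`. If the resulting `bound` exceeds 280, the search takes a symmetric
difference of two balls that `O` misses, and branches on its first codeword. `search_sound` turns a
successful run into the inequality, and the symmetries of the square leave five starting positions.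
-/

/-!
### Encoding of patterns by natural numbers

A cell `(x, y)` with `|x|, |y| ≤ 4` is encoded by the bit `40 + 9 * x + y`, so that a pattern around a
codeword placed at the origin is a natural number. Cells of a ball of radius `2` are encoded relative
to its centre by the bits `20 + 9 * x + y`. The functions below are evaluated by the kernel; they are
therefore written with recursors and with the primitive operations on `ℕ`.
-/

namespace GridCode

/-- The bits `20 + 9 * x + y` of the cells `(x, y)` with `|x| + |y| ≤ 2`. -/
def ball : Finset ℕ := {20, 11, 19, 21, 29, 2, 10, 12, 18, 22, 28, 30, 38}

/-- The mask with bits `ball`. -/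
def ballMask : ℕ := 276765088772

/-- The mask of the cell `(0, 0)`, in the frame of a ball. -/
def centreMask : ℕ := 1048576

/-- The mask of the cells `(±1, 0)` and `(0, ±1)`, in the frame of a ball. -/
def sideMask : ℕ := 539494400

/-- The mask of the cells `(±1, ±1)`, in the frame of a ball. -/
def diagMask : ℕ := 1342182400

/-- The mask of the cells `(±2, 0)` and `(0, ±2)`, in the frame of a ball. -/
def tipMask : ℕ := 274882363396

/-- The shifts `s` of the balls meeting the origin, each with the mask of the ball in the frame of the
pattern and the mask of the origin in the frame of the ball. -/
def balls : List (ℕ × ℕ × ℕ) := [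
  (290209229724188672, 20, 1048576), (566814901805056, 11, 536870912),
  (145104614862094336, 19, 2097152), (580418459448377344, 21, 524288),
  (148587125618784600064, 29, 2048), (1107060355088, 2, 274877906944),
  (283407450902528, 10, 1073741824), (1133629803610112, 12, 268435456),
  (72552307431047168, 18, 4194304), (1160836918896754688, 22, 262144),
  (74293562809392300032, 28, 4096), (297174251237569200128, 30, 1024),
  (76076608316817715232768, 38, 4)]

/-- The triples whose share is not divided evenly: mask of the triple, mask of its distinguished cell,
share of the distinguished cell, share of the other two. -/
def unevenTriples : List (ℕ × ℕ × ℕ × ℕ) := [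
  (4458496, 2048, 12, 18), (1342179328, 2048, 14, 17), (274878431236, 524288, 12, 18),
  (1074270208, 524288, 14, 17), (274880004100, 2097152, 12, 18), (270533632, 2097152, 14, 17),
  (536876032, 536870912, 14, 17), (541327360, 536870912, 12, 18), (274882102272, 1024, 14, 17),
  (274878173184, 4096, 14, 17), (272629764, 268435456, 14, 17), (1074003972, 1073741824, 14, 17)]

/-- The symmetric differences of two balls meeting the origin, in the order in which the search tries
them. -/
def separators : List ℕ := [
  148296925745655054336, 867233483892719616, 148006733573401870336, 289642433096982528,
  148586842773452230656, 144537825755275264, 289075651510550528, 433616741946359808,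
  289925823890198528, 148586000847409790976, 579851647780397056, 297317660405501263872,
  76076608315725752332304, 846907699113984, 74292442438211485696, 724389473527267328,
  146231641153486848, 580698555479494656, 148586558832903200768, 297246238396023570432,
  1693815398227968, 580417354583797776, 144821216548491264, 1414823190482944,
  148442021831781646336, 148658830202750631936, 579284866193965056, 72551213318565904,
  74003366786700935168, 75452145729452113920, 1161118118734467072, 76076536188788093747200,
  565707877142544, 296593851491310108672, 72268912877637632, 1132522749571088,
  290208122720514064, 74293561715281915920, 296013467146803740672, 297173685546904461312,
  145103516452548624, 297173117665806401536, 76076032433873812979712, 74148462872827527168,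
  296884043663563292672, 149741200541170532352, 148587124522526732304, 74293000423704895488,
  1160835818310365200, 76075461056728561352704, 74293279416451600384, 73683736063918080,
  76076608035076189458432, 444023543753072443392, 74221010915890823168, 362194736763633664,
  297174250137016365072, 282300440928272, 1159703295560794112, 76076607196448681902080,
  1161397110958989312, 1305934936689082368, 297173969487453491200, 1233387027304546304,
  216808370973179904, 74870600270585266176, 222011771876536221696, 75928025981775387820032,
  76076607755533686939648, 370887410445960871936, 76002315177872202924032, 73115820576743424,
  1734466967785439232, 652967468344541184, 1448778947054534656, 75779447589581757612032,
  76076463500007542095872, 76076318122446438793216]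

/-! ### The discharging rule and the search as kernel computations. -/

noncomputable def selectNat (b : Bool) (x y : ℕ) : ℕ := Bool.rec y x b

noncomputable def selectBool (b : Bool) (x y : Bool) : Bool := Bool.rec y x b

def misses (x y : ℕ) : Bool := Nat.beq (Nat.land x y) 0

/-- Clears the lowest bit. -/
def dropLow (x : ℕ) : ℕ := Nat.land x (Nat.sub x 1)

/-- What a tip gains from the other cell of a pair. -/
noncomputable def tipGain (T : ℕ) : ℕ :=
  selectNat (misses T sideMask)
    (selectNat (misses T diagMask) (selectNat (misses T centreMask) 0 1) 4) 2

/-- The tip gains exactly what its partner loses, so the total stays 48. Two tips share evenly. -/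
noncomputable def pairShare (T b : ℕ) : ℕ :=
  selectNat (misses b tipMask) (selectNat (misses T tipMask) 24 (Nat.sub 24 (tipGain b)))
    (Nat.add 24 (tipGain T))

noncomputable def tripleShare (T b : ℕ) (l : List (ℕ × ℕ × ℕ × ℕ)) : ℕ :=
  List.rec 16 (fun h _ ih =>
    selectNat (Nat.beq T h.1) (selectNat (Nat.beq b h.2.1) h.2.2.1 h.2.2.2) ih) l

noncomputable def shareOfThree (T b J : ℕ) : ℕ :=
  selectNat (Nat.beq J 0) (tripleShare T b unevenTriples) 12

noncomputable def shareOfTwo (T b J : ℕ) : ℕ :=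
  selectNat (Nat.beq J 0) (pairShare T b) (shareOfThree T b (dropLow J))

noncomputable def shareOfOne (T b J : ℕ) : ℕ :=
  selectNat (Nat.beq J 0) 48 (shareOfTwo T b (dropLow J))

/-- The share, in units of `1 / 48`, that a vertex with identifying set `T` gives to the codeword with
mask `b` in it. -/
noncomputable def share (T b : ℕ) : ℕ := shareOfOne T b (dropLow T)

/-- The values 28, 18 and 12 are the largest shares given by sets of two, three, and at least four
codewords. -/
noncomputable def nextCapAux (J : ℕ) : ℕ :=
  selectNat (Nat.beq J 0) 28 (selectNat (Nat.beq (dropLow J) 0) 18 12)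

/-- An upper bound for the shares given by a proper superset of `T`. -/
noncomputable def nextCap (T : ℕ) : ℕ := nextCapAux (dropLow T)

/-- Evaluates the argument before the function is applied. -/
noncomputable def forceNat (x : ℕ) (f : ℕ → ℕ) : ℕ :=
  Nat.rec (f 0) (fun n _ => f (Nat.succ n)) x

/-- Evaluates the argument before the predicate is applied. -/
noncomputable def forceBool (x : ℕ) (f : ℕ → Bool) : Bool :=
  Nat.rec (f 0) (fun n _ => f (Nat.succ n)) x

/-- The share that the ball with shift `s` gives to the origin if `t` is its trace. -/
noncomputable def traceShare (t s b : ℕ) : ℕ := share (Nat.shiftRight t s) b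

/-- Some ball with trace `t` on `O` has a key larger than `k`. -/
noncomputable def dominated (O t k : ℕ) (l : List (ℕ × ℕ × ℕ)) : Bool :=
  List.rec false (fun h _ ih => Bool.rec ih
    (Bool.rec true ih (Nat.ble (Nat.add (Nat.mul 64 (traceShare t h.2.1 h.2.2)) h.2.1) k))
    (Nat.beq (Nat.land O h.1) t)) l

/-- Of the balls with a common trace, only the one with the largest key keeps its share `w`. The key
orders by share and breaks ties by the shift, which is below 64. For `w ≤ 12` the comparison is
pointless, since no cap is below 12. -/
noncomputable def ballBound (O t w s : ℕ) : ℕ :=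
  Bool.rec (selectNat (dominated O t (Nat.add (Nat.mul 64 w) s) balls) (nextCap (Nat.shiftRight t s)) w)
    w (Nat.ble w 12)

/-- An upper bound for the sum of the shares given to the origin by the balls in `l` in a pattern that
contains `O` and separates the balls. -/
noncomputable def bound (O : ℕ) (l : List (ℕ × ℕ × ℕ)) : ℕ :=
  List.rec 0 (fun h _ ih => Nat.add (forceNat (Nat.land O h.1) fun t =>
    forceNat (traceShare t h.2.1 h.2.2) fun w => ballBound O t w h.2.1) ih) l

/-- The first separator missed by `O`, or `0`. -/
noncomputable def pick (O : ℕ) (l : List ℕ) : ℕ :=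
  List.rec 0 (fun m _ ih => selectNat (misses O m) m ih) l

/-- Checks `f` for each cell of `r`, added to `O` with the lower cells of `r` added to `Z`. -/
noncomputable def branch (f : ℕ → ℕ → Bool) (O n : ℕ) : ℕ → ℕ → Bool :=
  Nat.rec (fun _ r => Nat.beq r 0) (fun _ ih Z r => selectBool (Nat.beq r 0) true
    (selectBool (forceBool (Nat.lor O (Nat.xor r (dropLow r))) fun o => f o Z)
      (forceBool (Nat.lor Z (Nat.xor r (dropLow r))) fun z =>
        forceBool (dropLow r) fun q => ih z q) false)) n

noncomputable def expand (f : ℕ → ℕ → Bool) (O Z m : ℕ) : Bool :=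
  selectBool (Nat.beq m 0) false (branch f O 30 Z (Nat.xor m (Nat.land m Z)))

/-- Checks that the origin receives at most `280` in every pattern that contains `O`, misses `Z` and
separates the balls. -/
noncomputable def search (n : ℕ) : ℕ → ℕ → Bool :=
  Nat.rec (fun _ _ => false) (fun _ ih O Z =>
    selectBool (Nat.ble (bound O balls) 280) true (expand ih O Z (pick O separators))) n

/-- The five cases are named after the closest type of codeword present. The first mask holds the
origin and one representative of that type, the second the cells of the types already excluded. The
30 is a recursion depth; running out of it returns `false`, so it cannot affect soundness. -/
theorem search_side : search 30 564049465049088 0 = true := by decide +kernel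

theorem search_diag : search 30 1126999418470400 565700879974400 = true := by decide +kernel

theorem search_tip : search 30 288231475663339520 1973081132236800 = true := by decide +kernel

theorem search_knight : search 30 576461851815051264 290208130212560896 = true := by decide +kernel

theorem search_isolated : search 30 1099511627776 1013176617031172096 = true := by decide +kernel


/-! ### Masks as finite sets, and the totals of the discharging rule. -/

theorem selectNat_eq (b : Bool) (x y : ℕ) : selectNat b x y = if b then x else y := by
  cases b <;> rfl

theorem selectBool_eq (b x y : Bool) : selectBool b x y = if b then x else y := by
  cases b <;> rfl

theorem forceNat_eq (x : ℕ) (f : ℕ → ℕ) : forceNat x f = f x := by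
  cases x <;> rfl

theorem forceBool_eq (x : ℕ) (f : ℕ → Bool) : forceBool x f = f x := by
  cases x <;> rfl

theorem testBit_dropLow {r : ℕ} (hr : r ≠ 0) :
    ∃ i, r.testBit i = true ∧ ∀ j, (dropLow r).testBit j = (r.testBit j && decide (j ≠ i)) := by
  induction r using Nat.strong_induction_on with
  | _ r ih =>
    rcases Nat.even_or_odd' r with ⟨q, rfl | rfl⟩
    · obtain ⟨i, hi, hj⟩ := ih q (by omega) (by omega)
      refine ⟨i + 1, by simpa [Nat.testBit_succ] using hi, fun j => ?_⟩
      change ((2 * q) &&& (2 * q - 1)).testBit j = _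
      cases j with
      | zero => simp
      | succ j =>
        have h1 : (2 * q - 1) / 2 = q - 1 := by omega
        have h2 : (q &&& (q - 1)).testBit j = _ := hj j
        rw [Nat.testBit_and] at h2 ⊢
        simp [Nat.testBit_succ, h1, h2]
    · refine ⟨0, by simp, fun j => ?_⟩
      change ((2 * q + 1) &&& (2 * q)).testBit j = _
      cases j with
      | zero => simp
      | succ j =>
        have h1 : (2 * q + 1) / 2 = q := by omega
        rw [Nat.testBit_and]
        simp [Nat.testBit_succ, h1]

theorem dropLow_zero : dropLow 0 = 0 := rfl

theorem testBit_ballMask (i : ℕ) : ballMask.testBit i = decide (i ∈ ball) := by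
  by_cases hi : i < 39
  · have h : ∀ i < 39, ballMask.testBit i = decide (i ∈ ball) := by decide +kernel
    exact h i hi
  · have h1 : ballMask.testBit i = false :=
      Nat.testBit_lt_two_pow (lt_of_lt_of_le (by decide : ballMask < 2 ^ 39)
        (Nat.pow_le_pow_right (by norm_num) (by omega)))
    have h2 : ∀ i ∈ ball, i < 39 := by decide
    rw [h1, eq_comm, decide_eq_false_iff_not]
    exact fun h => hi (h2 i h)

/-- All bits of `T` encode cells of a ball. -/
def IsLocal (T : ℕ) : Prop := ∀ i, T.testBit i = true → i ∈ ball

/-- The set of bits of `T` in the frame of a ball. -/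
def bits (T : ℕ) : Finset ℕ := ball.filter fun i => T.testBit i = true

theorem IsLocal.mem_bits {T i : ℕ} (hT : IsLocal T) : i ∈ bits T ↔ T.testBit i = true := by
  rw [bits, Finset.mem_filter]
  exact ⟨And.right, fun h => ⟨hT i h, h⟩⟩

theorem IsLocal.eq_of_bits {T U : ℕ} (hT : IsLocal T) (hU : IsLocal U) (h : bits T = bits U) :
    T = U := by
  refine Nat.eq_of_testBit_eq fun i => Bool.eq_iff_iff.mpr ?_
  rw [← hT.mem_bits, ← hU.mem_bits, h]

theorem isLocal_and_ballMask (x : ℕ) : IsLocal (x &&& ballMask) := fun i hi => by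
  rw [Nat.testBit_and, Bool.and_eq_true, testBit_ballMask, decide_eq_true_eq] at hi
  exact hi.2

theorem isLocal_two_pow {a : ℕ} (ha : a ∈ ball) : IsLocal (2 ^ a) := fun i hi => by
  rw [Nat.testBit_two_pow] at hi
  simp only [decide_eq_true_eq] at hi
  exact hi ▸ ha

theorem IsLocal.or {T U : ℕ} (hT : IsLocal T) (hU : IsLocal U) : IsLocal (T ||| U) := fun i hi => by
  rw [Nat.testBit_or, Bool.or_eq_true] at hi
  exact hi.elim (hT i) (hU i)

theorem bits_two_pow {a : ℕ} (ha : a ∈ ball) : bits (2 ^ a) = {a} := by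
  ext i
  rw [(isLocal_two_pow ha).mem_bits, Nat.testBit_two_pow]
  simp [eq_comm]

theorem bits_or (T U : ℕ) : bits (T ||| U) = bits T ∪ bits U := by
  ext i
  simp only [bits, Finset.mem_filter, Finset.mem_union, Nat.testBit_or, Bool.or_eq_true]
  tauto

theorem IsLocal.eq_zero_iff {T : ℕ} (hT : IsLocal T) : T = 0 ↔ (bits T).card = 0 := by
  rw [Finset.card_eq_zero]
  constructor
  · rintro rfl
    simp [bits]
  · intro h
    exact hT.eq_of_bits (fun i hi => by simp at hi) (by rw [h]; simp [bits])

theorem IsLocal.dropLow {T : ℕ} (hT : IsLocal T) :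
    IsLocal (dropLow T) ∧ (bits (dropLow T)).card = (bits T).card - 1 := by
  rcases eq_or_ne T 0 with rfl | h
  · rw [dropLow_zero]
    exact ⟨hT, by simp [bits]⟩
  · obtain ⟨i, hi, hj⟩ := testBit_dropLow h
    have hl : IsLocal (GridCode.dropLow T) := fun j h => hT j (by
      rw [hj, Bool.and_eq_true] at h
      exact h.1)
    refine ⟨hl, ?_⟩
    have : bits (GridCode.dropLow T) = (bits T).erase i := by
      ext j
      rw [hl.mem_bits, Finset.mem_erase, hT.mem_bits, hj]
      simp [and_comm]
    rw [this, Finset.card_erase_of_mem (hT.mem_bits.mpr hi)]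

/-- Each `dropLow` removes one cell, so the nested zero tests count cells up to four. -/
theorem share_eq {T : ℕ} (hT : IsLocal T) (b : ℕ) :
    share T b = if (bits T).card ≤ 1 then 48 else if (bits T).card = 2 then pairShare T b
      else if (bits T).card = 3 then tripleShare T b unevenTriples else 12 := by
  obtain ⟨h1, c1⟩ := hT.dropLow
  obtain ⟨h2, c2⟩ := h1.dropLow
  obtain ⟨h3, c3⟩ := h2.dropLow
  simp only [share, shareOfOne, shareOfTwo, shareOfThree, selectNat_eq, Nat.beq_eq,
    h1.eq_zero_iff, h2.eq_zero_iff, h3.eq_zero_iff, c1, c2, c3]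
  split_ifs <;> first | rfl | omega

theorem nextCap_eq {T : ℕ} (hT : IsLocal T) :
    nextCap T = if (bits T).card ≤ 1 then 28 else if (bits T).card = 2 then 18 else 12 := by
  obtain ⟨h1, c1⟩ := hT.dropLow
  obtain ⟨h2, c2⟩ := h1.dropLow
  simp only [nextCap, nextCapAux, selectNat_eq, Nat.beq_eq, h1.eq_zero_iff, h2.eq_zero_iff, c1, c2]
  split_ifs <;> first | rfl | omega

/-- The extremes 20 and 28 come from the transfer of 4 between a diagonal cell and a tip. -/
theorem pairShare_spec : ∀ a ∈ ball, ∀ b ∈ ball, a ≠ b →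
    20 ≤ pairShare (2 ^ a ||| 2 ^ b) (2 ^ a) ∧ pairShare (2 ^ a ||| 2 ^ b) (2 ^ a) ≤ 28 ∧
    48 ≤ pairShare (2 ^ a ||| 2 ^ b) (2 ^ a) + pairShare (2 ^ a ||| 2 ^ b) (2 ^ b) := by
  decide +kernel

theorem tripleShare_spec : ∀ a ∈ ball, ∀ b ∈ ball, ∀ c ∈ ball, a ≠ b → a ≠ c → b ≠ c →
    12 ≤ tripleShare (2 ^ a ||| 2 ^ b ||| 2 ^ c) (2 ^ a) unevenTriples ∧
    tripleShare (2 ^ a ||| 2 ^ b ||| 2 ^ c) (2 ^ a) unevenTriples ≤ 18 ∧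
    48 ≤ tripleShare (2 ^ a ||| 2 ^ b ||| 2 ^ c) (2 ^ a) unevenTriples +
      tripleShare (2 ^ a ||| 2 ^ b ||| 2 ^ c) (2 ^ b) unevenTriples +
      tripleShare (2 ^ a ||| 2 ^ b ||| 2 ^ c) (2 ^ c) unevenTriples := by
  decide +kernel

theorem mem_ball_of_mem_bits {T i : ℕ} (h : i ∈ bits T) : i ∈ ball := (Finset.mem_filter.mp h).1

theorem IsLocal.eq_pair {T a b : ℕ} (hT : IsLocal T) (h : bits T = {a, b}) :
    a ∈ ball ∧ b ∈ ball ∧ T = 2 ^ a ||| 2 ^ b := by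
  have ha : a ∈ ball := mem_ball_of_mem_bits (T := T) (by simp [h])
  have hb : b ∈ ball := mem_ball_of_mem_bits (T := T) (by simp [h])
  refine ⟨ha, hb, hT.eq_of_bits ((isLocal_two_pow ha).or (isLocal_two_pow hb)) ?_⟩
  rw [h, bits_or, bits_two_pow ha, bits_two_pow hb]
  rfl

theorem IsLocal.eq_triple {T a b c : ℕ} (hT : IsLocal T) (h : bits T = {a, b, c}) :
    a ∈ ball ∧ b ∈ ball ∧ c ∈ ball ∧ T = 2 ^ a ||| 2 ^ b ||| 2 ^ c := by
  have ha : a ∈ ball := mem_ball_of_mem_bits (T := T) (by simp [h])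
  have hb : b ∈ ball := mem_ball_of_mem_bits (T := T) (by simp [h])
  have hc : c ∈ ball := mem_ball_of_mem_bits (T := T) (by simp [h])
  refine ⟨ha, hb, hc, hT.eq_of_bits
    (((isLocal_two_pow ha).or (isLocal_two_pow hb)).or (isLocal_two_pow hc)) ?_⟩
  rw [h, bits_or, bits_or, bits_two_pow ha, bits_two_pow hb, bits_two_pow hc]
  ext; simp

theorem exists_eq_pair {s : Finset ℕ} (hs : s.card = 2) {a : ℕ} (ha : a ∈ s) :
    ∃ b, a ≠ b ∧ s = {a, b} := by
  obtain ⟨x, y, hxy, rfl⟩ := Finset.card_eq_two.mp hs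
  rcases Finset.mem_insert.mp ha with rfl | h
  · exact ⟨y, hxy, rfl⟩
  · rw [Finset.mem_singleton] at h
    subst h
    exact ⟨x, hxy.symm, Finset.pair_comm _ _⟩

theorem exists_eq_triple {s : Finset ℕ} (hs : s.card = 3) {a : ℕ} (ha : a ∈ s) :
    ∃ b c, a ≠ b ∧ a ≠ c ∧ b ≠ c ∧ s = {a, b, c} := by
  have : (s.erase a).card = 2 := by rw [Finset.card_erase_of_mem ha, hs]
  obtain ⟨b, c, hbc, h⟩ := Finset.card_eq_two.mp this
  have hb : b ∈ s.erase a := by simp [h]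
  have hc : c ∈ s.erase a := by simp [h]
  exact ⟨b, c, (Finset.ne_of_mem_erase hb).symm, (Finset.ne_of_mem_erase hc).symm, hbc,
    by rw [← h, Finset.insert_erase ha]⟩

/-- The least and the largest share given by a set of a given cardinality. -/
theorem share_mem_Icc {T a : ℕ} (hT : IsLocal T) (ha : a ∈ bits T) :
    ((bits T).card = 1 → share T (2 ^ a) = 48) ∧
    ((bits T).card = 2 → 20 ≤ share T (2 ^ a) ∧ share T (2 ^ a) ≤ 28) ∧
    ((bits T).card = 3 → 12 ≤ share T (2 ^ a) ∧ share T (2 ^ a) ≤ 18) ∧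
    (4 ≤ (bits T).card → share T (2 ^ a) = 12) := by
  rw [share_eq hT]
  refine ⟨fun h => by simp [h], fun h => ?_, fun h => ?_, fun h => ?_⟩
  · obtain ⟨b, hab, hs⟩ := exists_eq_pair h ha
    obtain ⟨h1, h2, rfl⟩ := hT.eq_pair hs
    obtain ⟨h3, h4, -⟩ := pairShare_spec a h1 b h2 hab
    simp [h, h3, h4]
  · obtain ⟨b, c, hab, hac, hbc, hs⟩ := exists_eq_triple h ha
    obtain ⟨h1, h2, h3, rfl⟩ := hT.eq_triple hs
    obtain ⟨h4, h5, -⟩ := tripleShare_spec a h1 b h2 c h3 hab hac hbc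
    simp [h, h4, h5]
  · rw [if_neg (by omega), if_neg (by omega), if_neg (by omega)]

theorem twelve_le_share {T a : ℕ} (hT : IsLocal T) (ha : a ∈ bits T) : 12 ≤ share T (2 ^ a) := by
  obtain ⟨h1, h2, h3, h4⟩ := share_mem_Icc hT ha
  have : 0 < (bits T).card := Finset.card_pos.mpr ⟨a, ha⟩
  rcases (by omega : (bits T).card = 1 ∨ (bits T).card = 2 ∨ (bits T).card = 3 ∨
    4 ≤ (bits T).card) with h | h | h | h
  · have := h1 h; omega
  · have := h2 h; omega
  · have := h3 h; omega
  · have := h4 h; omega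

theorem nextCap_le_share {T a : ℕ} (hT : IsLocal T) (ha : a ∈ bits T) :
    nextCap T ≤ share T (2 ^ a) := by
  obtain ⟨h1, h2, h3, h4⟩ := share_mem_Icc hT ha
  have := twelve_le_share hT ha
  have : 0 < (bits T).card := Finset.card_pos.mpr ⟨a, ha⟩
  rw [nextCap_eq hT]
  split_ifs
  · have := h1 (by omega); omega
  · have := h2 (by omega); omega
  · omega

theorem share_le_nextCap {T U a : ℕ} (hT : IsLocal T) (hU : IsLocal U) (ha : a ∈ bits U)
    (h : bits T ⊂ bits U) (h0 : a ∈ bits T) : share U (2 ^ a) ≤ nextCap T := by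
  obtain ⟨h1, h2, h3, h4⟩ := share_mem_Icc hU ha
  have hc := Finset.card_lt_card h
  have : 0 < (bits T).card := Finset.card_pos.mpr ⟨a, h0⟩
  rw [nextCap_eq hT]
  rcases (by omega : (bits U).card = 2 ∨ (bits U).card = 3 ∨ 4 ≤ (bits U).card) with h | h | h
  · have := h2 h
    rw [if_pos (by omega)]; omega
  · have := h3 h
    split_ifs <;> omega
  · have := h4 h
    split_ifs <;> omega

/-- A vertex distributes at least `48` to its identifying set. -/
theorem le_sum_share {T : ℕ} (hT : IsLocal T) (h0 : T ≠ 0) :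
    48 ≤ ∑ a ∈ bits T, share T (2 ^ a) := by
  have hpos : (bits T).card ≠ 0 := fun h => h0 (hT.eq_zero_iff.mpr h)
  rcases (by omega : (bits T).card = 1 ∨ (bits T).card = 2 ∨ (bits T).card = 3 ∨
    4 ≤ (bits T).card) with h | h | h | h
  · obtain ⟨a, ha⟩ := Finset.card_eq_one.mp h
    rw [ha, Finset.sum_singleton, (share_mem_Icc hT (by simp [ha])).1 h]
  · obtain ⟨a, b, hab, hs⟩ := Finset.card_eq_two.mp h
    have e : ∀ x, share T x = pairShare T x := fun x => by rw [share_eq hT]; simp [h]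
    obtain ⟨h1, h2, rfl⟩ := hT.eq_pair hs
    rw [hs, Finset.sum_pair hab, e, e]
    exact (pairShare_spec a h1 b h2 hab).2.2
  · obtain ⟨a, b, c, hab, hac, hbc, hs⟩ := Finset.card_eq_three.mp h
    have e : ∀ x, share T x = tripleShare T x unevenTriples := fun x => by
      rw [share_eq hT]; simp [h]
    obtain ⟨h1, h2, h3, rfl⟩ := hT.eq_triple hs
    rw [hs, Finset.sum_insert (by simp [hab, hac]), Finset.sum_pair hbc, e, e, e, ← add_assoc]
    exact (tripleShare_spec a h1 b h2 c h3 hab hac hbc).2.2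
  · have := Finset.card_nsmul_le_sum (bits T) (fun a => share T (2 ^ a)) 12
      fun a ha => twelve_le_share hT ha
    rw [smul_eq_mul] at this
    omega


/-! ### An upper bound for what the origin receives, from partial knowledge. -/

/-- In a group with common `t`, at most one index `e` exceeds the common cap `n`. Its `W e` is at
most `w e`, hence at most `w m = U m` for `m` of maximal key; the remaining terms on the left are at
most `n`, and those on the right at least `n`. -/
theorem sum_le_sum_of_groups {ι τ : Type*} [DecidableEq ι] [DecidableEq τ] (S : Finset ι) (t : ι → τ)
    (key w W n U : ι → ℕ) (hn : ∀ i ∈ S, n i ≤ U i)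
    (hW : ∀ i ∈ S, W i ≤ n i ∨ W i ≤ w i ∧ ∀ j ∈ S, j ≠ i → t j = t i → W j ≤ n j)
    (hU : ∀ i ∈ S, (∀ j ∈ S, t j = t i → key j ≤ key i) → U i = w i)
    (hkey : ∀ i ∈ S, ∀ j ∈ S, key j ≤ key i → w j ≤ w i)
    (ht : ∀ i ∈ S, ∀ j ∈ S, t i = t j → n i = n j) : ∑ i ∈ S, W i ≤ ∑ i ∈ S, U i := by
  rw [← Finset.sum_fiberwise_of_maps_to (fun i hi => Finset.mem_image_of_mem t hi) W,
    ← Finset.sum_fiberwise_of_maps_to (fun i hi => Finset.mem_image_of_mem t hi) U]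
  refine Finset.sum_le_sum fun x _ => ?_
  by_cases h : ∀ i ∈ S.filter (t · = x), W i ≤ n i
  · exact Finset.sum_le_sum fun i hi => (h i hi).trans (hn i (Finset.mem_filter.mp hi).1)
  · push Not at h
    obtain ⟨e, he, hlt⟩ := h
    obtain ⟨heS, hex⟩ := Finset.mem_filter.mp he
    obtain ⟨h1, h2⟩ := (hW e heS).resolve_left (by omega)
    obtain ⟨m, hm, hmax⟩ := Finset.exists_max_image _ key ⟨e, he⟩
    obtain ⟨hmS, hmx⟩ := Finset.mem_filter.mp hm
    rw [← Finset.add_sum_erase _ _ he, ← Finset.add_sum_erase _ _ hm]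
    have key1 : W e ≤ U m := by
      rw [hU m hmS fun j hj hjm => hmax j (Finset.mem_filter.mpr ⟨hj, hjm.trans hmx⟩)]
      exact h1.trans (hkey m hmS e heS (hmax e he))
    have key2 : ∑ i ∈ (S.filter (t · = x)).erase e, W i ≤
        ((S.filter (t · = x)).erase e).card • n e := by
      refine Finset.sum_le_card_nsmul _ _ _ fun j hj => ?_
      obtain ⟨hne, hj⟩ := Finset.mem_erase.mp hj
      obtain ⟨hjS, hjx⟩ := Finset.mem_filter.mp hj
      rw [ht e heS j hjS (hex.trans hjx.symm)]
      exact h2 j hjS hne (hjx.trans hex.symm)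
    have key3 : ((S.filter (t · = x)).erase m).card • n e ≤
        ∑ i ∈ (S.filter (t · = x)).erase m, U i := by
      refine Finset.card_nsmul_le_sum _ _ _ fun j hj => ?_
      obtain ⟨hjS, hjx⟩ := Finset.mem_filter.mp (Finset.mem_of_mem_erase hj)
      rw [ht e heS j hjS (hex.trans hjx.symm)]
      exact hn j hjS
    rw [Finset.card_erase_of_mem hm] at key3
    rw [Finset.card_erase_of_mem he] at key2
    omega

/-- The part of the pattern `F` in the ball with shift `s`, in the frame of the ball. -/
def localMask (F s : ℕ) : ℕ := (F >>> s) &&& ballMask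

/-- What the origin receives in the pattern `F`. -/
noncomputable def received (F : ℕ) : ℕ := ∑ s ∈ ball, share (localMask F s) (2 ^ (40 - s))

/-- The pattern `F` contains the origin and separates the vertices of the ball around it. -/
structure IsPattern (F : ℕ) : Prop where
  origin : F.testBit 40 = true
  separates : ∀ s ∈ ball, ∀ t ∈ ball, s ≠ t → F &&& (ballMask <<< s ^^^ ballMask <<< t) ≠ 0

theorem isLocal_localMask (F s : ℕ) : IsLocal (localMask F s) := isLocal_and_ballMask _

theorem testBit_localMask (F s i : ℕ) :
    (localMask F s).testBit i = (F.testBit (s + i) && decide (i ∈ ball)) := by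
  rw [localMask, Nat.testBit_and, Nat.testBit_shiftRight, testBit_ballMask]

theorem mem_bits_localMask {F s i : ℕ} :
    i ∈ bits (localMask F s) ↔ F.testBit (s + i) = true ∧ i ∈ ball := by
  rw [(isLocal_localMask F s).mem_bits, testBit_localMask, Bool.and_eq_true, decide_eq_true_eq]

theorem ball_spec : ∀ s ∈ ball, s < 39 ∧ s ≤ 40 ∧ 40 - s ∈ ball := by decide

theorem balls_spec : ∀ h ∈ balls, h.2.1 ∈ ball ∧ h.1 = ballMask <<< h.2.1 ∧
    h.2.2 = 2 ^ (40 - h.2.1) := by decide +kernel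

theorem sum_balls (g : ℕ → ℕ) : (balls.map fun h => g h.2.1).sum = ∑ s ∈ ball, g s := by
  have h1 : ball = (balls.map fun h => h.2.1).toFinset := by decide +kernel
  have h2 : (balls.map fun h => h.2.1).Nodup := by decide +kernel
  rw [h1, List.sum_toFinset _ h2, List.map_map]
  rfl

theorem trace_shiftRight (F s : ℕ) : (F &&& ballMask <<< s) >>> s = localMask F s := by
  refine Nat.eq_of_testBit_eq fun i => ?_
  rw [testBit_localMask, Nat.testBit_shiftRight, Nat.testBit_and, Nat.testBit_shiftLeft,
    Nat.add_sub_cancel_left, testBit_ballMask]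
  simp

theorem trace_eq (F s : ℕ) : F &&& ballMask <<< s = localMask F s <<< s := by
  refine Nat.eq_of_testBit_eq fun i => ?_
  rw [Nat.testBit_and, Nat.testBit_shiftLeft, Nat.testBit_shiftLeft, testBit_localMask,
    testBit_ballMask]
  by_cases h : s ≤ i
  · simp [h]
  · simp [h]

/-- The codewords of a ball are counted in the frame of the pattern instead of the frame of the
ball, so that balls with equal traces can be compared. -/
theorem card_bits_localMask (F s : ℕ) : (bits (localMask F s)).card =
    ((Finset.range 81).filter fun i => (F &&& ballMask <<< s).testBit i = true ∧ s < 39).card ∨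
      39 ≤ s := by
  by_cases hs : s < 39
  · left
    refine Finset.card_nbij' (fun i => s + i) (fun i => i - s) ?_ ?_ ?_ ?_
    · intro i hi
      obtain ⟨h1, h2⟩ := mem_bits_localMask.mp hi
      have := (ball_spec i h2).1
      simp only [Finset.coe_filter, Set.mem_ofPred_eq, Finset.mem_range]
      refine ⟨by omega, ?_, hs⟩
      rw [Nat.testBit_and, Nat.testBit_shiftLeft, testBit_ballMask]
      simp [h1, h2]
    · intro i hi
      simp only [Finset.coe_filter, Set.mem_ofPred_eq, Finset.mem_range, Nat.testBit_and,
        Nat.testBit_shiftLeft, testBit_ballMask, Bool.and_eq_true, decide_eq_true_eq] at hi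
      refine Finset.mem_coe.mpr (mem_bits_localMask.mpr ⟨?_, hi.2.1.2.2⟩)
      rw [Nat.add_sub_cancel' hi.2.1.2.1]
      exact hi.2.1.1
    · intro i _
      simp
    · intro i hi
      simp only [Finset.coe_filter, Set.mem_ofPred_eq, Finset.mem_range, Nat.testBit_and,
        Nat.testBit_shiftLeft, Bool.and_eq_true, decide_eq_true_eq] at hi
      exact Nat.add_sub_cancel' hi.2.1.2.1
  · right
    omega

theorem nextCap_congr {F s t : ℕ} (hs : s ∈ ball) (ht : t ∈ ball)
    (h : F &&& ballMask <<< s = F &&& ballMask <<< t) :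
    nextCap (localMask F s) = nextCap (localMask F t) := by
  have h1 := (card_bits_localMask F s).resolve_right (by have := (ball_spec s hs).1; omega)
  have h2 := (card_bits_localMask F t).resolve_right (by have := (ball_spec t ht).1; omega)
  simp only [h, (ball_spec s hs).1, (ball_spec t ht).1] at h1 h2
  rw [nextCap_eq (isLocal_localMask F s), nextCap_eq (isLocal_localMask F t), h1, h2]

theorem dominated_eq_true {O t k : ℕ} (l : List (ℕ × ℕ × ℕ)) : dominated O t k l = true ↔
    ∃ h ∈ l, O &&& h.1 = t ∧ k < 64 * traceShare t h.2.1 h.2.2 + h.2.1 := by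
  induction l with
  | nil => simp [dominated]
  | cons h l ih =>
    have e : dominated O t k (h :: l) = if O &&& h.1 = t then
        (if 64 * traceShare t h.2.1 h.2.2 + h.2.1 ≤ k then dominated O t k l else true)
        else dominated O t k l := by
      change selectBool (Nat.beq (O &&& h.1) t) (selectBool
        (Nat.ble (64 * traceShare t h.2.1 h.2.2 + h.2.1) k) (dominated O t k l) true)
        (dominated O t k l) = _
      simp only [selectBool_eq, Nat.beq_eq, Nat.ble_eq]
    rw [e]
    simp only [List.mem_cons, exists_eq_or_imp]
    split_ifs with h1 h2
    · rw [ih]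
      constructor
      · exact Or.inr
      · rintro (h3 | h3)
        · omega
        · exact h3
    · simp only [true_iff]
      exact Or.inl ⟨h1, by omega⟩
    · rw [ih]
      simp [h1]

/-- The bound for the share of the ball with shift `s` in a pattern that contains `O`. -/
noncomputable def cappedShare (O s : ℕ) : ℕ :=
  ballBound O (O &&& ballMask <<< s) (share (localMask O s) (2 ^ (40 - s))) s

theorem bound_balls (O : ℕ) : bound O balls = ∑ s ∈ ball, cappedShare O s := by
  have key : ∀ l : List (ℕ × ℕ × ℕ), (∀ h ∈ l, h ∈ balls) →
      bound O l = (l.map fun h => cappedShare O h.2.1).sum := by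
    intro l
    induction l with
    | nil => intro; rfl
    | cons h l ih =>
      intro hl
      obtain ⟨-, h2, h3⟩ := balls_spec h (hl h (by simp))
      rw [List.map_cons, List.sum_cons, ← ih fun x hx => hl x (by simp [hx])]
      change forceNat (O &&& h.1) (fun t => forceNat (traceShare t h.2.1 h.2.2) fun w =>
        ballBound O t w h.2.1) + bound O l = _
      rw [forceNat_eq, forceNat_eq, cappedShare, ← trace_shiftRight, ← h2, ← h3]
      rfl
  rw [key balls fun _ h => h, sum_balls]

theorem cappedShare_eq (O s : ℕ) :
    cappedShare O s = share (localMask O s) (2 ^ (40 - s)) ∨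
    cappedShare O s = nextCap (localMask O s) ∧ ∃ t ∈ ball,
      O &&& ballMask <<< t = O &&& ballMask <<< s ∧
      64 * share (localMask O s) (2 ^ (40 - s)) + s <
        64 * share (localMask O t) (2 ^ (40 - t)) + t := by
  have e : cappedShare O s = if share (localMask O s) (2 ^ (40 - s)) ≤ 12 then
      share (localMask O s) (2 ^ (40 - s)) else
      if dominated O (O &&& ballMask <<< s) (64 * share (localMask O s) (2 ^ (40 - s)) + s) balls
        then nextCap (localMask O s) else share (localMask O s) (2 ^ (40 - s)) := by
    change selectNat (Nat.ble (share (localMask O s) (2 ^ (40 - s))) 12)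
      (share (localMask O s) (2 ^ (40 - s))) (selectNat (dominated O (O &&& ballMask <<< s)
        (64 * share (localMask O s) (2 ^ (40 - s)) + s) balls)
        (nextCap ((O &&& ballMask <<< s) >>> s)) (share (localMask O s) (2 ^ (40 - s)))) = _
    simp only [selectNat_eq, Nat.ble_eq, trace_shiftRight]
  rw [e]
  split_ifs with h1 h2
  · exact Or.inl rfl
  · obtain ⟨h, hh, h3, h4⟩ := (dominated_eq_true balls).mp h2
    obtain ⟨b1, b2, b3⟩ := balls_spec h hh
    refine Or.inr ⟨rfl, h.2.1, b1, b2 ▸ h3, ?_⟩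
    rw [← h3, b2, b3] at h4
    rwa [← trace_shiftRight O h.2.1]
  · exact Or.inl rfl


theorem and_eq_left_iff {O F : ℕ} :
    O &&& F = O ↔ ∀ i, O.testBit i = true → F.testBit i = true := by
  constructor
  · intro h i hi
    rw [← h, Nat.testBit_and, Bool.and_eq_true] at hi
    exact hi.2
  · intro h
    refine Nat.eq_of_testBit_eq fun i => ?_
    rw [Nat.testBit_and]
    cases hO : O.testBit i
    · rfl
    · rw [h i hO]; rfl

/-- The groups are the balls with equal trace on `O`. A ball that gains a codeword in `F` is capped
by `nextCap`, and separation allows only one ball of a group to gain none. -/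
theorem received_le_bound {O F : ℕ} (hF : IsPattern F) (h0 : O.testBit 40 = true)
    (hO : O &&& F = O) : received F ≤ bound O balls := by
  rw [bound_balls, received]
  rw [and_eq_left_iff] at hO
  have h40 : ∀ s ∈ ball, ∀ G : ℕ, G.testBit 40 = true → 40 - s ∈ bits (localMask G s) := by
    intro s hs G hG
    obtain ⟨-, h1, h2⟩ := ball_spec s hs
    rw [mem_bits_localMask, Nat.add_sub_cancel' h1]
    exact ⟨hG, h2⟩
  have hsub : ∀ s, bits (localMask O s) ⊆ bits (localMask F s) := fun s i hi => by
    rw [mem_bits_localMask] at hi ⊢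
    exact ⟨hO _ hi.1, hi.2⟩
  have hne : ∀ s ∈ ball, localMask F s ≠ localMask O s →
      share (localMask F s) (2 ^ (40 - s)) ≤ nextCap (localMask O s) := by
    intro s hs h
    refine share_le_nextCap (isLocal_localMask O s) (isLocal_localMask F s)
      (h40 s hs F hF.origin) ?_ (h40 s hs O h0)
    exact (hsub s).ssubset_of_ne fun h' =>
      h ((isLocal_localMask F s).eq_of_bits (isLocal_localMask O s) h'.symm)
  refine sum_le_sum_of_groups ball (fun s => O &&& ballMask <<< s)
    (fun s => 64 * share (localMask O s) (2 ^ (40 - s)) + s)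
    (fun s => share (localMask O s) (2 ^ (40 - s))) _ (fun s => nextCap (localMask O s)) _
    ?_ ?_ ?_ ?_ ?_
  · intro s hs
    rcases cappedShare_eq O s with h | ⟨h, -⟩
    · rw [h]
      exact nextCap_le_share (isLocal_localMask O s) (h40 s hs O h0)
    · exact h.ge
  · intro s hs
    by_cases h : localMask F s = localMask O s
    · refine Or.inr ⟨by rw [h], fun t ht hts htr => hne t ht fun h' => ?_⟩
      -- If neither ball gained a codeword, both would still have the same trace in `F`.
      refine hF.separates t ht s hs hts ?_
      have h1 : F &&& ballMask <<< t = F &&& ballMask <<< s := by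
        rw [trace_eq F, trace_eq F, h, h', ← trace_eq, ← trace_eq]
        exact htr
      rw [Nat.and_xor_distrib_left, h1, Nat.xor_self]
    · exact Or.inl (hne s hs h)
  · intro s hs hmax
    rcases cappedShare_eq O s with h | ⟨-, t, ht, h1, h2⟩
    · exact h
    · exact absurd (hmax t ht h1) (by simpa using h2)
  · intro s hs t ht h
    have := (ball_spec s hs).1
    have := (ball_spec t ht).1
    change 64 * _ + t ≤ 64 * _ + s at h
    change share _ _ ≤ share _ _
    omega
  · intro s hs t ht h
    exact nextCap_congr hs ht h

/-! ### Soundness of the search. -/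

theorem pick_mem (O : ℕ) (l : List ℕ) : pick O l = 0 ∨ pick O l ∈ l := by
  induction l with
  | nil => exact Or.inl rfl
  | cons m l ih =>
    have e : pick O (m :: l) = if misses O m then m else pick O l := selectNat_eq _ _ _
    rw [e]
    split_ifs
    · simp
    · exact ih.imp id (List.mem_cons_of_mem m)

theorem separators_spec : ∀ m ∈ separators, ∃ s ∈ ball, ∃ t ∈ ball, s ≠ t ∧
    m = ballMask <<< s ^^^ ballMask <<< t := by
  decide +kernel

/-- Since `F` meets `r`, there is a lowest cell of `r` in `F`. The branch that adds this cell to `O`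
and all lower cells of `r` to `Z` describes `F` correctly. -/
theorem branch_sound {f : ℕ → ℕ → Bool} {O F : ℕ} {P : Prop} (hO : O &&& F = O)
    (hf : ∀ o z, f o z = true → O &&& o = O → o &&& F = o → z &&& F = 0 → P) (n Z r : ℕ)
    (h : branch f O n Z r = true) (hZ : Z &&& F = 0) (hr : r &&& F ≠ 0) : P := by
  induction n generalizing Z r with
  | zero =>
    rw [(Nat.beq_eq ▸ h : r = 0), Nat.zero_and] at hr
    exact absurd rfl hr
  | succ n ih =>
    have e : branch f O (n + 1) Z r = if r = 0 then true else if f (O ||| (r ^^^ dropLow r)) Z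
        then branch f O n (Z ||| (r ^^^ dropLow r)) (dropLow r) else false := by
      change selectBool (Nat.beq r 0) true (selectBool
        (forceBool (O ||| (r ^^^ dropLow r)) fun o => f o Z)
        (forceBool (Z ||| (r ^^^ dropLow r)) fun z =>
          forceBool (dropLow r) fun q => branch f O n z q) false) = _
      simp only [selectBool_eq, Nat.beq_eq, forceBool_eq]
    have hr0 : r ≠ 0 := fun h0 => hr (by rw [h0, Nat.zero_and])
    rw [e, if_neg hr0] at h
    obtain ⟨i, hi, hj⟩ := testBit_dropLow hr0
    have hb : r ^^^ dropLow r = 2 ^ i := by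
      refine Nat.eq_of_testBit_eq fun j => ?_
      rw [Nat.testBit_xor, hj, Nat.testBit_two_pow]
      by_cases hji : j = i
      · subst hji; simp [hi]
      · simp [hji, Ne.symm hji]
    rw [hb] at h
    split_ifs at h with h1
    · cases hF : F.testBit i
      · refine ih _ _ h ?_ ?_
        · refine Nat.eq_of_testBit_eq fun j => ?_
          have hZj : (Z &&& F).testBit j = false := by rw [hZ, Nat.zero_testBit]
          rw [Nat.testBit_and] at hZj
          rw [Nat.testBit_and, Nat.testBit_or, Nat.testBit_two_pow, Nat.zero_testBit]
          by_cases hji : i = j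
          · subst hji; simp [hF]
          · simpa [hji] using hZj
        · intro h0
          refine hr (Nat.eq_of_testBit_eq fun j => ?_)
          have hdj : (dropLow r &&& F).testBit j = false := by rw [h0, Nat.zero_testBit]
          rw [Nat.testBit_and, hj] at hdj
          rw [Nat.testBit_and, Nat.zero_testBit]
          by_cases hji : j = i
          · subst hji; simp [hF]
          · simpa [hji] using hdj
      · refine hf _ _ h1 ?_ ?_ hZ
        · refine and_eq_left_iff.mpr fun j hj => ?_
          rw [Nat.testBit_or, hj, Bool.true_or]
        · refine and_eq_left_iff.mpr fun j hj => ?_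
          rw [Nat.testBit_or, Bool.or_eq_true, Nat.testBit_two_pow, decide_eq_true_eq] at hj
          rcases hj with hj | rfl
          · exact and_eq_left_iff.mp hO j hj
          · exact hF

theorem expand_eq (f : ℕ → ℕ → Bool) (O Z m : ℕ) : expand f O Z m =
    if m = 0 then false else branch f O 30 Z (m ^^^ (m &&& Z)) := by
  rw [expand, selectBool_eq]
  simp only [Nat.beq_eq]
  rfl

theorem search_sound {F : ℕ} (hF : IsPattern F) (n O Z : ℕ) (h : search n O Z = true)
    (h0 : O.testBit 40 = true) (hO : O &&& F = O) (hZ : Z &&& F = 0) : received F ≤ 280 := by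
  induction n generalizing O Z with
  | zero => exact absurd h (by change ¬ false = true; decide)
  | succ n ih =>
    have e : search (n + 1) O Z = if bound O balls ≤ 280 then true else
        if pick O separators = 0 then false else branch (search n) O 30 Z
          (pick O separators ^^^ (pick O separators &&& Z)) := by
      rw [← expand_eq]
      change selectBool (Nat.ble (bound O balls) 280) true
        (expand (search n) O Z (pick O separators)) = _
      rw [selectBool_eq]
      simp only [Nat.ble_eq]
    rw [e] at h
    split_ifs at h with h1 h2
    · exact (received_le_bound hF h0 hO).trans h1
    · obtain ⟨s, hs, t, ht, hst, hm⟩ := separators_spec _ ((pick_mem O separators).resolve_left h2)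
      refine branch_sound hO (fun o z h3 h4 h5 h6 => ih o z h3 ?_ h5 h6) _ _ _ h hZ ?_
      · exact and_eq_left_iff.mp h4 40 h0
      -- The separator meets `F` while `Z` does not, so it still meets `F` after the cells of `Z`
      -- are removed.
      · intro h3
        refine hF.separates s hs t ht hst (Nat.eq_of_testBit_eq fun j => ?_)
        have h4 : ((pick O separators ^^^ (pick O separators &&& Z)) &&& F).testBit j = false := by
          rw [h3, Nat.zero_testBit]
        have h5 : (Z &&& F).testBit j = false := by rw [hZ, Nat.zero_testBit]
        rw [← hm, Nat.testBit_and, Nat.zero_testBit]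
        rw [Nat.testBit_and, Nat.testBit_xor, Nat.testBit_and] at h4
        rw [Nat.testBit_and] at h5
        revert h4 h5
        cases F.testBit j <;> cases Z.testBit j <;> cases (pick O separators).testBit j <;> simp


/-! ### Symmetry -/

/-- The action of the symmetries of the square, numbered by `k < 8`, on the bits of a pattern. -/
def turn (k i : ℕ) : ℕ :=
  let x := if k % 2 = 1 then 8 - i / 9 else i / 9
  let y := if k / 2 % 2 = 1 then 8 - i % 9 else i % 9
  if k / 4 = 1 then 9 * y + x else 9 * x + y

/-- The action of the symmetries of the square on the bits of a ball. -/
def localTurn (k i : ℕ) : ℕ := turn k (i + 20) - 20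

/-- The image of a pattern under a symmetry of the square. -/
def turned (k F : ℕ) : ℕ := Nat.ofBits fun i : Fin 81 => F.testBit (turn k i)

/-- Symmetries act linearly on offsets from the centre, and sums of two ball offsets have
coordinates at most 4 in absolute value, so the base 9 encoding never carries. -/
theorem turn_add : ∀ k < 8, ∀ s ∈ ball, ∀ i ∈ ball, s + i < 81 ∧
    turn k (s + i) = localTurn k s + localTurn k i := by
  decide +kernel

theorem localTurn_mem : ∀ k < 8, ∀ s ∈ ball, localTurn k s ∈ ball ∧
    localTurn k (40 - s) = 40 - localTurn k s := by
  decide +kernel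

theorem image_localTurn : ∀ k < 8, ball.image (localTurn k) = ball := by decide +kernel

theorem localTurn_inj : ∀ k < 8, ∀ a ∈ ball, ∀ b ∈ ball, localTurn k a = localTurn k b → a = b := by
  decide +kernel

theorem pairShare_turn : ∀ k < 8, ∀ a ∈ ball, ∀ b ∈ ball, a ≠ b →
    pairShare (2 ^ localTurn k a ||| 2 ^ localTurn k b) (2 ^ localTurn k a) =
      pairShare (2 ^ a ||| 2 ^ b) (2 ^ a) := by
  decide +kernel

theorem tripleShare_turn : ∀ k < 8, ∀ a ∈ ball, ∀ b ∈ ball, ∀ c ∈ ball, a ≠ b → a ≠ c → b ≠ c →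
    tripleShare (2 ^ localTurn k a ||| 2 ^ localTurn k b ||| 2 ^ localTurn k c)
      (2 ^ localTurn k a) unevenTriples =
    tripleShare (2 ^ a ||| 2 ^ b ||| 2 ^ c) (2 ^ a) unevenTriples := by
  decide +kernel

theorem share_turn {k T U a : ℕ} (hk : k < 8) (hT : IsLocal T) (hU : IsLocal U)
    (h : bits U = (bits T).image (localTurn k)) (ha : a ∈ bits T) :
    share U (2 ^ localTurn k a) = share T (2 ^ a) := by
  have hc : (bits U).card = (bits T).card := by
    rw [h]
    exact Finset.card_image_of_injOn fun x hx y hy hxy =>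
      localTurn_inj k hk x (mem_ball_of_mem_bits hx) y (mem_ball_of_mem_bits hy) hxy
  rw [share_eq hT, share_eq hU, hc]
  split_ifs with h1 h2 h3
  · rfl
  · obtain ⟨b, hab, hs⟩ := exists_eq_pair h2 ha
    obtain ⟨ha', hb, rfl⟩ := hT.eq_pair hs
    rw [hs, Finset.image_insert, Finset.image_singleton] at h
    obtain ⟨-, -, rfl⟩ := hU.eq_pair h
    exact pairShare_turn k hk a ha' b hb hab
  · obtain ⟨b, c, hab, hac, hbc, hs⟩ := exists_eq_triple h3 ha
    obtain ⟨ha', hb, hc', rfl⟩ := hT.eq_triple hs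
    rw [hs, Finset.image_insert, Finset.image_insert, Finset.image_singleton] at h
    obtain ⟨-, -, -, rfl⟩ := hU.eq_triple h
    exact tripleShare_turn k hk a ha' b hb c hc' hab hac hbc
  · rfl

theorem testBit_turned {k F i : ℕ} (hi : i < 81) :
    (turned k F).testBit i = F.testBit (turn k i) := by
  rw [turned, Nat.testBit_ofBits_lt _ _ hi]

theorem bits_localMask_turned {k F s : ℕ} (hk : k < 8) (hs : s ∈ ball) :
    bits (localMask F (localTurn k s)) =
      (bits (localMask (turned k F) s)).image (localTurn k) := by
  ext j
  rw [Finset.mem_image, mem_bits_localMask]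
  constructor
  · rintro ⟨h1, h2⟩
    rw [← image_localTurn k hk] at h2
    obtain ⟨i, hi, rfl⟩ := Finset.mem_image.mp h2
    obtain ⟨h3, h4⟩ := turn_add k hk s hs i hi
    refine ⟨i, mem_bits_localMask.mpr ⟨?_, hi⟩, rfl⟩
    rwa [testBit_turned h3, h4]
  · rintro ⟨i, hi, rfl⟩
    obtain ⟨h1, h2⟩ := mem_bits_localMask.mp hi
    obtain ⟨h3, h4⟩ := turn_add k hk s hs i h2
    rw [testBit_turned h3, h4] at h1
    exact ⟨h1, (localTurn_mem k hk i h2).1⟩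

theorem received_turned {k F : ℕ} (hk : k < 8) (h : (turned k F).testBit 40 = true) :
    received (turned k F) = received F := by
  rw [received, received]
  conv_rhs => rw [← image_localTurn k hk]
  rw [Finset.sum_image fun x hx y hy hxy => localTurn_inj k hk x hx y hy hxy]
  refine Finset.sum_congr rfl fun s hs => ?_
  obtain ⟨-, h1, h2⟩ := ball_spec s hs
  rw [← (localTurn_mem k hk s hs).2]
  refine (share_turn hk (isLocal_localMask _ _) (isLocal_localMask _ _)
    (bits_localMask_turned hk hs) (mem_bits_localMask.mpr ⟨?_, h2⟩)).symm
  rwa [Nat.add_sub_cancel' h1]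

/-- Separation is expressed through offsets inside the two balls, the form that is transported both
by symmetries and to the grid. -/
theorem trace_eq_iff (F s t : ℕ) : F &&& (ballMask <<< s ^^^ ballMask <<< t) = 0 ↔
    (∀ i ∈ bits (localMask F s), ∃ j ∈ ball, s + i = t + j) ∧
    ∀ i ∈ bits (localMask F t), ∃ j ∈ ball, t + i = s + j := by
  have key : ∀ s t, (∀ i ∈ bits (localMask F s), ∃ j ∈ ball, s + i = t + j) ↔
      ∀ i, F.testBit i = true → (ballMask <<< s).testBit i = true →
        (ballMask <<< t).testBit i = true := by
    intro s t
    simp only [mem_bits_localMask, Nat.testBit_shiftLeft, testBit_ballMask, Bool.and_eq_true,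
      decide_eq_true_eq]
    constructor
    · rintro h i h1 ⟨h2, h3⟩
      obtain ⟨j, hj, hij⟩ := h (i - s) ⟨by rwa [Nat.add_sub_cancel' h2], h3⟩
      exact ⟨by omega, by rwa [show i - t = j by omega]⟩
    · rintro h i ⟨h1, h2⟩
      obtain ⟨h3, h4⟩ := h (s + i) h1 ⟨by omega, by rwa [Nat.add_sub_cancel_left]⟩
      exact ⟨_, h4, by omega⟩
  rw [key, key]
  constructor
  · intro h
    have h' : ∀ i, F.testBit i = true → (ballMask <<< s).testBit i = (ballMask <<< t).testBit i := by
      intro i hi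
      have : (F &&& (ballMask <<< s ^^^ ballMask <<< t)).testBit i = false := by
        rw [h, Nat.zero_testBit]
      rw [Nat.testBit_and, Nat.testBit_xor, hi, Bool.true_and] at this
      simpa using this
    exact ⟨fun i h1 h2 => h' i h1 ▸ h2, fun i h1 h2 => (h' i h1).symm ▸ h2⟩
  · rintro ⟨h1, h2⟩
    refine Nat.eq_of_testBit_eq fun i => ?_
    rw [Nat.testBit_and, Nat.testBit_xor, Nat.zero_testBit]
    cases hF : F.testBit i
    · rfl
    · rw [Bool.true_and, Bool.eq_iff_iff.mpr ⟨h1 i hF, h2 i hF⟩, Bool.xor_self]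

theorem IsPattern.turned {k F : ℕ} (hk : k < 8) (hF : IsPattern F) : IsPattern (turned k F) := by
  refine ⟨?_, fun s hs t ht hst h => ?_⟩
  · have : ∀ k < 8, turn k 40 = 40 := by decide
    rw [testBit_turned (by norm_num), this k hk]
    exact hF.origin
  · refine hF.separates _ (localTurn_mem k hk s hs).1 _ (localTurn_mem k hk t ht).1
      (fun h' => hst (localTurn_inj k hk s hs t ht h')) ?_
    have key : ∀ s ∈ ball, ∀ t ∈ ball,
        (∀ i ∈ bits (localMask (GridCode.turned k F) s), ∃ j ∈ ball, s + i = t + j) →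
        ∀ i ∈ bits (localMask F (localTurn k s)), ∃ j ∈ ball,
          localTurn k s + i = localTurn k t + j := by
      intro s hs t ht h i hi
      rw [bits_localMask_turned hk hs] at hi
      obtain ⟨i, hi', rfl⟩ := Finset.mem_image.mp hi
      obtain ⟨j, hj, hij⟩ := h i hi'
      refine ⟨localTurn k j, (localTurn_mem k hk j hj).1, ?_⟩
      rw [← (turn_add k hk s hs i (mem_ball_of_mem_bits hi')).2, ← (turn_add k hk t ht j hj).2, hij]
    rw [trace_eq_iff] at h ⊢
    exact ⟨key s hs t ht h.1, key t ht s hs h.2⟩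

/-! ### Reduction to the five starting positions. -/

/-- The number with the given set of bits. -/
def maskOf (l : List ℕ) : ℕ := l.foldr (fun i m => 2 ^ i ||| m) 0

theorem testBit_maskOf (l : List ℕ) (j : ℕ) : (maskOf l).testBit j = decide (j ∈ l) := by
  induction l with
  | nil => simp [maskOf]
  | cons i l ih =>
    change (2 ^ i ||| maskOf l).testBit j = _
    rw [Nat.testBit_or, ih, Nat.testBit_two_pow]
    simp [eq_comm]

theorem received_le_of_search {F : ℕ} (hF : IsPattern F) {O Z : ℕ} (h : search 30 O Z = true)
    (lO lZ : List ℕ) (eO : O = maskOf lO) (eZ : Z = maskOf lZ) (h0 : 40 ∈ lO)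
    (hO : ∀ i ∈ lO, F.testBit i = true) (hZ : ∀ i ∈ lZ, F.testBit i = false) :
    received F ≤ 280 := by
  refine search_sound hF 30 O Z h ?_ (and_eq_left_iff.mpr fun i hi => ?_)
    (Nat.eq_of_testBit_eq fun i => ?_)
  · rw [eO, testBit_maskOf]
    exact decide_eq_true h0
  · rw [eO, testBit_maskOf, decide_eq_true_eq] at hi
    exact hO i hi
  · rw [eZ, Nat.testBit_and, testBit_maskOf, Nat.zero_testBit]
    by_cases hi : i ∈ lZ
    · rw [hZ i hi, Bool.and_false]
    · rw [decide_eq_false hi, Bool.false_and]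

/-- Each list is an orbit of the symmetry group of the square, headed by the representative used in
the searches. -/
def sideBits : List ℕ := [49, 31, 41, 39]
def diagBits : List ℕ := [50, 32, 48, 30]
def tipBits : List ℕ := [58, 22, 42, 38]
def knightBits : List ℕ := [59, 57, 51, 47, 33, 29, 23, 21]

/-- In a pattern the origin receives at most `280`. -/
theorem received_le {F : ℕ} (hF : IsPattern F) : received F ≤ 280 := by
  have turn_mem : ∀ k < 8, ∀ l ∈ [sideBits, diagBits, tipBits], ∀ i ∈ l, i < 81 ∧ turn k i ∈ l := by
    decide +kernel
  have orbit : ∀ l ∈ [sideBits, diagBits, tipBits, knightBits], ∀ j ∈ l, ∃ k < 8,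
      turn k (l.headD 0) = j := by
    decide +kernel
  -- Emptiness of an orbit survives turning, so each case may assume that the earlier orbits contain
  -- no codeword.
  have avoid : ∀ k < 8, ∀ l ∈ [sideBits, diagBits, tipBits], (∀ i ∈ l, F.testBit i = false) →
      ∀ i ∈ l, (turned k F).testBit i = false := by
    intro k hk l hl h i hi
    obtain ⟨h1, h2⟩ := turn_mem k hk l hl i hi
    rw [testBit_turned h1]
    exact h _ h2
  have reach : ∀ l ∈ [sideBits, diagBits, tipBits, knightBits], (∀ i ∈ l, F.testBit i = false) ∨
      ∃ k < 8, (turned k F).testBit (l.headD 0) = true := by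
    intro l hl
    by_contra! h
    obtain ⟨⟨j, hj, hFj⟩, h⟩ := h
    obtain ⟨k, hk, hkj⟩ := orbit l hl j hj
    have hlt : ∀ l ∈ [sideBits, diagBits, tipBits, knightBits], l.headD 0 < 81 := by decide
    refine h k hk ?_
    rw [testBit_turned (hlt l hl), hkj]
    simpa using hFj
  have close : ∀ k < 8, received (turned k F) ≤ 280 → received F ≤ 280 := fun k hk h =>
    (received_turned hk (hF.turned hk).origin) ▸ h
  rcases reach sideBits (by simp) with side | ⟨k, hk, h⟩
  swap
  · refine close k hk (received_le_of_search (hF.turned hk) search_side [40, 49] [] (by decide)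
      (by decide) (by simp) ?_ (by simp))
    simpa [(hF.turned hk).origin] using (show (turned k F).testBit 49 = true from h)
  rcases reach diagBits (by simp) with diag | ⟨k, hk, h⟩
  swap
  · refine close k hk (received_le_of_search (hF.turned hk) search_diag [40, 50] sideBits
      (by decide) (by decide) (by simp) ?_ (avoid k hk _ (by simp) side))
    simpa [(hF.turned hk).origin] using (show (turned k F).testBit 50 = true from h)
  rcases reach tipBits (by simp) with tip | ⟨k, hk, h⟩
  swap
  · refine close k hk (received_le_of_search (hF.turned hk) search_tip [40, 58]
      (sideBits ++ diagBits) (by decide) (by decide) (by simp) ?_ ?_)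
    · simpa [(hF.turned hk).origin] using (show (turned k F).testBit 58 = true from h)
    · intro i hi
      rcases List.mem_append.mp hi with hi | hi
      · exact avoid k hk _ (by simp) side i hi
      · exact avoid k hk _ (by simp) diag i hi
  rcases reach knightBits (by simp) with knight | ⟨k, hk, h⟩
  swap
  · refine close k hk (received_le_of_search (hF.turned hk) search_knight [40, 59]
      (sideBits ++ diagBits ++ tipBits) (by decide) (by decide) (by simp) ?_ ?_)
    · simpa [(hF.turned hk).origin] using (show (turned k F).testBit 59 = true from h)
    · intro i hi
      rcases List.mem_append.mp hi with hi | hi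
      · rcases List.mem_append.mp hi with hi | hi
        · exact avoid k hk _ (by simp) side i hi
        · exact avoid k hk _ (by simp) diag i hi
      · exact avoid k hk _ (by simp) tip i hi
  · refine received_le_of_search hF search_isolated [40]
      (sideBits ++ diagBits ++ tipBits ++ knightBits) (by decide) (by decide) (by simp)
      (by simpa using hF.origin) ?_
    intro i hi
    simp only [List.mem_append] at hi
    rcases hi with ((hi | hi) | hi) | hi
    · exact side i hi
    · exact diag i hi
    · exact tip i hi
    · exact knight i hi


/-! ### Counting in the grid -/

theorem squareGrid_adj {u v : ℤ × ℤ} :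
    squareGrid.Adj u v ↔ (v.1 - u.1).natAbs + (v.2 - u.2).natAbs = 1 := by
  obtain ⟨a, b⟩ := u
  obtain ⟨c, d⟩ := v
  simp only [squareGrid, Prod.mk_sub_mk, Set.mem_insert_iff, Set.mem_singleton_iff, Prod.mk.injEq]
  omega

/-- Together with `abs_le_length`, this identifies the graph distance with the ℓ¹ distance. -/
theorem edist_le_of_abs_le (n : ℕ) (u v : ℤ × ℤ) (h : (v.1 - u.1).natAbs + (v.2 - u.2).natAbs ≤ n) :
    squareGrid.edist u v ≤ n := by
  induction n generalizing u with
  | zero =>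
    have : u = v := by ext <;> omega
    simp [this]
  | succ n ih =>
    have step : ∀ w : ℤ × ℤ, (w.1 - u.1).natAbs + (w.2 - u.2).natAbs = 1 → (v.1 - w.1).natAbs + (v.2 - w.2).natAbs ≤ n →
        squareGrid.edist u v ≤ (n + 1 : ℕ) := fun w h1 h2 => by
      refine SimpleGraph.edist_triangle.trans ((add_le_add
        (SimpleGraph.edist_eq_one_iff_adj.mpr (squareGrid_adj.mpr h1)).le (ih w h2)).trans ?_)
      rw [add_comm]
      push_cast
      exact le_rfl
    rcases lt_trichotomy u.1 v.1 with h1 | h1 | h1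
    · exact step (u.1 + 1, u.2) (by simp) (by dsimp only; omega)
    · rcases lt_trichotomy u.2 v.2 with h2 | h2 | h2
      · exact step (u.1, u.2 + 1) (by simp) (by dsimp only; omega)
      · simp [show u = v from Prod.ext h1 h2]
      · exact step (u.1, u.2 - 1) (by simp) (by dsimp only; omega)
    · exact step (u.1 - 1, u.2) (by simp) (by dsimp only; omega)

theorem abs_le_length {u v : ℤ × ℤ} (p : squareGrid.Walk u v) :
    (v.1 - u.1).natAbs + (v.2 - u.2).natAbs ≤ p.length := by
  induction p with
  | nil => simp
  | cons h p ih =>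
    have := squareGrid_adj.mp h
    rw [SimpleGraph.Walk.length_cons]
    omega

/-- The cell encoded by the bit `i` of a pattern. -/
def cell (i : ℕ) : ℤ × ℤ := ((i / 9 : ℕ) - 4, (i % 9 : ℕ) - 4)

theorem cell_ball : ∀ i ∈ ball, (cell (20 + i)).1.natAbs + (cell (20 + i)).2.natAbs ≤ 2 := by decide +kernel

theorem cell_add : ∀ s ∈ ball, ∀ i ∈ ball, s + i < 81 ∧
    cell (s + i) = cell (20 + s) + cell (20 + i) := by decide +kernel

theorem cell_sub : ∀ i ∈ ball, cell (20 + i) = - cell (20 + (40 - i)) := by decide +kernel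

theorem mem_graphBall {u x : ℤ × ℤ} :
    x ∈ graphBall squareGrid 2 u ↔ ∃ i ∈ ball, x = u + cell (20 + i) := by
  constructor
  · intro h
    have h' : squareGrid.edist u x ≤ (2 : ℕ) := h
    obtain ⟨p, hp⟩ := SimpleGraph.exists_walk_of_edist_ne_top
      (ne_top_of_le_ne_top (ENat.natCast_ne_top 2) h')
    rw [← hp, Nat.cast_le] at h'
    have h1 := abs_le_length p
    have h2 : (x.1 - u.1).natAbs + (x.2 - u.2).natAbs ≤ 2 := by omega
    have key : ∀ a ∈ Finset.Icc (-2 : ℤ) 2, ∀ b ∈ Finset.Icc (-2 : ℤ) 2, a.natAbs + b.natAbs ≤ 2 →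
        ∃ i ∈ ball, (a, b) = cell (20 + i) := by decide +kernel
    obtain ⟨i, hi, hx⟩ := key (x.1 - u.1) (Finset.mem_Icc.mpr ⟨by omega, by omega⟩) (x.2 - u.2)
      (Finset.mem_Icc.mpr ⟨by omega, by omega⟩) h2
    exact ⟨i, hi, by rw [← hx]; ext <;> simp⟩
  · rintro ⟨i, hi, rfl⟩
    refine edist_le_of_abs_le 2 _ _ ?_
    simpa using cell_ball i hi

open Classical in
/-- The pattern of `C` around the vertex `c`. -/
noncomputable def pattern (C : Set (ℤ × ℤ)) (c : ℤ × ℤ) : ℕ :=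
  Nat.ofBits fun i : Fin 81 => decide (c + cell i ∈ C)

theorem testBit_pattern {C : Set (ℤ × ℤ)} {c : ℤ × ℤ} {i : ℕ} (hi : i < 81) :
    (pattern C c).testBit i = true ↔ c + cell i ∈ C := by
  classical
  rw [pattern, Nat.testBit_ofBits_lt _ _ hi, decide_eq_true_iff]

theorem mem_bits_localMask_pattern {C : Set (ℤ × ℤ)} {c : ℤ × ℤ} {s i : ℕ} (hs : s ∈ ball) :
    i ∈ bits (localMask (pattern C c) s) ↔ c + cell (20 + s) + cell (20 + i) ∈ C ∧ i ∈ ball := by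
  rw [mem_bits_localMask]
  refine and_congr_left fun hi => ?_
  obtain ⟨h1, h2⟩ := cell_add s hs i hi
  rw [testBit_pattern h1, h2, add_assoc]

/-- The mask of a vertex does not depend on the codeword from which it is seen, so what vertices
give can be matched with what codewords receive. -/
theorem localMask_pattern (C : Set (ℤ × ℤ)) (c : ℤ × ℤ) {s : ℕ} (hs : s ∈ ball) :
    localMask (pattern C c) s = localMask (pattern C (c + cell (20 + s))) 20 := by
  refine (isLocal_localMask _ _).eq_of_bits (isLocal_localMask _ _) ?_
  ext i
  rw [mem_bits_localMask_pattern hs, mem_bits_localMask_pattern (by decide),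
    show cell (20 + 20) = 0 by decide, add_zero]

theorem isPattern_pattern {C : Set (ℤ × ℤ)} (hC : IsIdentifyingCode squareGrid 2 C) {c : ℤ × ℤ}
    (hc : c ∈ C) : IsPattern (pattern C c) := by
  refine ⟨?_, fun s hs t ht hst h => ?_⟩
  · rwa [testBit_pattern (by norm_num), show cell 40 = 0 by decide, add_zero]
  · have inj : ∀ s ∈ ball, ∀ t ∈ ball, cell (20 + s) = cell (20 + t) → s = t := by decide +kernel
    refine hC.separates (c + cell (20 + s)) (c + cell (20 + t))
      (fun h' => hst (inj s hs t ht (add_left_cancel h'))) ?_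
    have key : ∀ s ∈ ball, ∀ t ∈ ball,
        (∀ i ∈ bits (localMask (pattern C c) s), ∃ j ∈ ball, s + i = t + j) →
        identifyingSet squareGrid 2 C (c + cell (20 + s)) ⊆
          identifyingSet squareGrid 2 C (c + cell (20 + t)) := by
      rintro s hs t ht h x ⟨hx, hxC⟩
      obtain ⟨i, hi, rfl⟩ := mem_graphBall.mp hx
      obtain ⟨j, hj, hij⟩ := h i ((mem_bits_localMask_pattern hs).mpr ⟨hxC, hi⟩)
      refine ⟨mem_graphBall.mpr ⟨j, hj, ?_⟩, hxC⟩
      rw [add_assoc, add_assoc, ← (cell_add s hs i hi).2, ← (cell_add t ht j hj).2, hij]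
    rw [trace_eq_iff] at h
    exact (key s hs t ht h.1).antisymm (key t ht s hs h.2)

theorem localMask_pattern_ne_zero {C : Set (ℤ × ℤ)} (hC : IsIdentifyingCode squareGrid 2 C)
    (v : ℤ × ℤ) : localMask (pattern C v) 20 ≠ 0 := by
  obtain ⟨x, hx, hxC⟩ := hC.covers v
  obtain ⟨i, hi, rfl⟩ := mem_graphBall.mp hx
  intro h
  have := ((isLocal_localMask (pattern C v) 20).eq_zero_iff).mp h
  rw [Finset.card_eq_zero] at this
  refine Finset.notMem_empty i (this ▸ (mem_bits_localMask_pattern (by decide)).mpr ⟨?_, hi⟩)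
  rwa [show cell (20 + 20) = 0 by decide, add_zero]

/-! ### Double counting in squares and the density. -/

/-- The square with vertices `(x, y)`, `|x|, |y| ≤ n`, as a finite set. -/
noncomputable def box (n : ℕ) : Finset (ℤ × ℤ) := Finset.Icc (-n : ℤ) n ×ˢ Finset.Icc (-n : ℤ) n

theorem coe_box (n : ℕ) : (box n : Set (ℤ × ℤ)) = gridSquare n := by
  ext ⟨x, y⟩
  simp [box, gridSquare, abs_le, and_and_and_comm]

theorem card_box (n : ℕ) : (box n).card = (2 * n + 1) ^ 2 := by
  rw [box, Finset.card_product, Int.card_Icc, sq, show ((n : ℤ) + 1 - -n).toNat = 2 * n + 1 by omega]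

theorem add_cell_mem_box {n i : ℕ} {v : ℤ × ℤ} (hv : v ∈ box n) (hi : i ∈ ball) :
    v + cell (20 + i) ∈ box (n + 2) := by
  have := cell_ball i hi
  simp only [box, Finset.mem_product, Finset.mem_Icc, Prod.fst_add, Prod.snd_add] at hv ⊢
  push_cast
  omega

open Classical in
/-- The shares given by the vertices of a square are received in a slightly larger square. -/
theorem card_box_le {C : Set (ℤ × ℤ)} (hC : IsIdentifyingCode squareGrid 2 C) (n : ℕ) :
    48 * (box n).card ≤ 280 * ((box (n + 2)).filter (· ∈ C)).card := by
  have h20 : (20 : ℕ) ∈ ball := by decide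
  have c0 : cell (20 + 20) = 0 := by decide
  let g : ℤ × ℤ → ℕ → ℕ := fun v i => share (localMask (pattern C v) 20) (2 ^ i)
  have gather : ∀ c, ∑ i ∈ ball, g (c - cell (20 + i)) i = received (pattern C c) := by
    intro c
    -- If the codeword has offset `i` from the giving vertex, the vertex has the opposite offset,
    -- encoded by `40 - i`, from the codeword.
    refine Finset.sum_nbij' (40 - ·) (40 - ·) (fun i hi => (ball_spec i hi).2.2)
      (fun i hi => (ball_spec i hi).2.2) (fun i hi => ?_) (fun i hi => ?_) fun i hi => ?_
    · have := (ball_spec i hi).1; omega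
    · have := (ball_spec i hi).1; omega
    · obtain ⟨h1, -, h2⟩ := ball_spec i hi
      rw [localMask_pattern C c h2, cell_sub i hi, sub_neg_eq_add,
        show 40 - (40 - i) = i by omega]
  calc 48 * (box n).card = ∑ v ∈ box n, 48 := by
        rw [Finset.sum_const, smul_eq_mul, mul_comm]
    _ ≤ ∑ v ∈ box n, ∑ i ∈ bits (localMask (pattern C v) 20), g v i :=
        Finset.sum_le_sum fun v _ =>
          le_sum_share (isLocal_localMask _ _) (localMask_pattern_ne_zero hC v)
    _ = ∑ i ∈ ball, ∑ v ∈ (box n).filter (fun v => v + cell (20 + i) ∈ C), g v i := by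
        refine Finset.sum_comm' fun v i => ?_
        rw [mem_bits_localMask_pattern h20, c0, add_zero, Finset.mem_filter, and_assoc]
    _ ≤ ∑ i ∈ ball, ∑ c ∈ (box (n + 2)).filter (· ∈ C), g (c - cell (20 + i)) i := by
        refine Finset.sum_le_sum fun i hi => ?_
        have e : ∑ v ∈ (box n).filter (fun v => v + cell (20 + i) ∈ C), g v i =
            ∑ c ∈ ((box n).filter (fun v => v + cell (20 + i) ∈ C)).image (· + cell (20 + i)),
              g (c - cell (20 + i)) i := by
          rw [Finset.sum_image fun x _ y _ h => add_right_cancel h]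
          simp only [add_sub_cancel_right]
        rw [e]
        refine Finset.sum_le_sum_of_subset fun c hc => ?_
        obtain ⟨v, hv, rfl⟩ := Finset.mem_image.mp hc
        obtain ⟨hv, hvC⟩ := Finset.mem_filter.mp hv
        exact Finset.mem_filter.mpr ⟨add_cell_mem_box hv hi, hvC⟩
    _ = ∑ c ∈ (box (n + 2)).filter (· ∈ C), received (pattern C c) := by
        rw [Finset.sum_comm]
        exact Finset.sum_congr rfl fun c _ => gather c
    _ ≤ ((box (n + 2)).filter (· ∈ C)).card • 280 :=
        Finset.sum_le_card_nsmul _ _ _ fun c hc =>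
          received_le (isPattern_pattern hC (Finset.mem_filter.mp hc).2)
    _ = _ := by rw [smul_eq_mul, mul_comm]

theorem ncard_gridSquare (n : ℕ) : (gridSquare n).ncard = (2 * n + 1) ^ 2 := by
  rw [← coe_box, Set.ncard_coe_finset, card_box]

theorem le_ncard_inter {C : Set (ℤ × ℤ)} (hC : IsIdentifyingCode squareGrid 2 C) (n : ℕ) :
    48 * (2 * n + 1) ^ 2 ≤ 280 * (C ∩ gridSquare (n + 2)).ncard := by
  classical
  have e : C ∩ gridSquare (n + 2) = ((box (n + 2)).filter (· ∈ C) : Finset (ℤ × ℤ)) := by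
    rw [Finset.coe_filter, ← coe_box]
    ext x
    exact and_comm
  rw [e, Set.ncard_coe_finset, ← card_box]
  exact card_box_le hC n

open Filter Topology in
theorem tendsto_ratio :
    Tendsto (fun n : ℕ => (6 : ℝ) / 35 * (1 - 4 / (2 * n + 1)) ^ 2) atTop (𝓝 (6 / 35)) := by
  have h : Tendsto (fun n : ℕ => (2 * n + 1 : ℝ)) atTop atTop :=
    tendsto_atTop_add_const_right _ _ (tendsto_natCast_atTop_atTop.const_mul_atTop two_pos)
  have h1 := ((h.const_div_atTop 4).const_sub 1).pow 2 |>.const_mul (6 / 35 : ℝ)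
  simpa using h1

end GridCode

open GridCode in
theorem theorem3p4 (C : Set (ℤ × ℤ)) (hC : IsIdentifyingCode squareGrid 2 C) :
    (6 : ℝ) / 35 ≤ gridDensity C := by
  rw [← tendsto_ratio.limsup_eq, gridDensity]
  -- Real `limsup` needs boundedness; the ratio is at most 1.
  refine Filter.limsup_le_limsup ?_ tendsto_ratio.isCoboundedUnder_le
    (Filter.isBoundedUnder_of ⟨1, fun n => ?_⟩)
  · filter_upwards [Filter.eventually_ge_atTop 2] with n hn
    obtain ⟨m, rfl⟩ := Nat.exists_eq_add_of_le' hn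
    have h : (48 : ℝ) * (2 * m + 1) ^ 2 ≤ 280 * (C ∩ gridSquare (m + 2)).ncard := by
      exact_mod_cast le_ncard_inter hC m
    rw [ncard_gridSquare]
    push_cast
    have h0 : (0 : ℝ) < 2 * (m + 2) + 1 := by positivity
    -- With `n = m + 2`, the side `2 * n + 1` exceeds the side `2 * m + 1` of the inner square by 4,
    -- whence the factor `1 - 4 / (2 * n + 1)`.
    rw [le_div_iff₀ (by positivity), mul_assoc, ← mul_pow,
      show (1 - 4 / (2 * ((m : ℝ) + 2) + 1)) * (2 * (m + 2) + 1) = 2 * m + 1 by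
        rw [sub_mul, div_mul_cancel₀ _ h0.ne']; ring]
    linarith
  · refine div_le_one_of_le₀ ?_ (Nat.cast_nonneg _)
    have hf : (gridSquare n).Finite := coe_box n ▸ (box n).finite_toSet
    exact_mod_cast Set.ncard_le_ncard Set.inter_subset_right hf
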